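/- Let $\mathbb S^1=\mathbb R/\mathbb Z$, let $f:\mathbb S^1\times\mathbb R\to\mathbb R$ be smooth, and let $F:B^1\to B^0$, $F(u)(t)=u'(t)+f(t,u(t))$, where either $B^1=C^1(\mathbb S^1;\mathbb R)$, $B^0=C^0(\mathbb S^1;\mathbb R)$, or $B^1=H^1(\mathbb S^1;\mathbb R)$ (the periodic absolutely continuous functions with derivative in $L^2$), $B^0=L^2(\mathbb S^1;\mathbb R)$. All averages $\int$ are over $\mathbb S^1$. Let $\Psi:B^1\to B^0$, $\Psi(u)=F(u)-\int F(u)+\int u$. Put $\phi(z)=\int F(\Psi^{-1}(z))$ for $z\in\Psi(B^1)$, so that $F\circ\Psi^{-1}$ is $(\tilde v,\bar u)\mapsto(\tilde v,\phi(\tilde v,\bar u))$ in the decomposition of $B^0$ into functions of average zero and constants. Let $D_2$ denote differentiation in the direction of the constant function $1$, and let $$S_k=\{u\in B^1 : D_2\phi(\Psi(u))=\cdots=D_2^k\phi(\Psi(u))=0\},\qquad k\ge 0 .$$ For $v\in B^0$ the return map $\rho_v:I\to\mathbb R$ sends $w(0)$ to $w(1)$ whenever $w:[0,1]\to\mathbb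 R$ satisfies $w'(t)+f(t,w(t))=v(t)$ (classically in the first case; in the second case, $w$ is absolutely continuous and the equation holds almost everywhere); here $I$ is the set of initial conditions $w(0)$ of all such $w$. **Proposition 2.3.** Let $u\in B^1$ and $v=F(u)$. The objects above are well defined near $u$: $\Psi$ is injective, $\Psi(u)+s\in\Psi(B^1)$ for all small real $s$, and $s\mapsto\phi(\Psi(u)+s)$ is smooth at $s=0$; $\rho_v(w(0))=w(1)$ does not depend on the choice of the solution $w$, $I$ is a neighbourhood of $u(0)$, and $\rho_v$ is smooth at $u(0)$. (Here a function is smooth at a point if, for every $n$, it is $C^n$ in some neighbourhood of the point.) Moreover: 1. $\rho_v(u(0))=u(0)$. 2. For every $k\ge1$: $u\in S_k$ if and only if $\rho_v'(u(0))=1$ and $\rho_v^{(i)}(u(0))=0$ for $i=2,\dots,k$. In particular, $u\in S_1$ if and only if $\rho_v'(u(0))=1$. 3. The order of $u$, that is, the largest $k\ge 0$ with $u\in S_k$ ($\infty$ if there is no largest), equals the order of contact of $\rho_v$ with the identity at $u(0)$, that is, the largest $k\ge0$ such that the derivatives of $\rho_v$ and of the identity of every order $i\le k$ agree at $u(0)$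 ($\infty$ if there is no largest). -/

import Mathlib

open MeasureTheory Set
open scoped ContDiff Topology

namespace PeriodicODE

/-! Functions on the circle `ℝ / ℤ` are functions on `UnitAddCircle`; its `volume` has mass `1`. -/

/-- A smooth nonlinearity `f : 𝕊¹ × ℝ → ℝ`; smoothness is tested on the universal cover. -/
structure Nonlinearity where
  toFun : UnitAddCircle → ℝ → ℝ
  smooth : ContDiff ℝ ∞ (fun p : ℝ × ℝ => toFun (p.1 : UnitAddCircle) p.2)

instance : CoeFun Nonlinearity (fun _ => UnitAddCircle → ℝ → ℝ) := ⟨Nonlinearity.toFun⟩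

/-- The derivative of a function on the circle. -/
noncomputable def circleDeriv (u : UnitAddCircle → ℝ) (x : UnitAddCircle) : ℝ :=
  deriv (fun s : ℝ => u (x + (s : UnitAddCircle))) 0

/-- The differential expression `u'(t) + f(t, u(t))`. -/
noncomputable def odeOp (f : Nonlinearity) (u : UnitAddCircle → ℝ) (x : UnitAddCircle) : ℝ :=
  circleDeriv u x + f x (u x)

/-- The average `∫ g` over the circle. -/
noncomputable def mean (g : UnitAddCircle → ℝ) : ℝ := ∫ x, g x

theorem continuous_of_lift {g : UnitAddCircle → ℝ}
    (h : Continuous (fun t : ℝ => g (t : UnitAddCircle))) : Continuous g :=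
  isQuotientMap_quotient_mk'.continuous_iff.2 h

theorem circleDeriv_coe (u : UnitAddCircle → ℝ) (t : ℝ) :
    circleDeriv u (t : UnitAddCircle) = deriv (fun s : ℝ => u (s : UnitAddCircle)) t := by
  have h := deriv_comp_const_add (fun s : ℝ => u (s : UnitAddCircle)) t 0
  simpa [circleDeriv, AddCircle.coe_add] using h

theorem continuous_nemytskii (f : Nonlinearity) (u : C(UnitAddCircle, ℝ)) :
    Continuous (fun x => f x (u x)) := by
  apply continuous_of_lift
  have h : Continuous (fun t : ℝ => (t, u (t : UnitAddCircle))) :=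
    continuous_id.prodMk (u.continuous.comp (AddCircle.continuous_mk' 1))
  exact f.smooth.continuous.comp h

/-! ### The two choices of function spaces -/

/-- `C¹(𝕊¹; ℝ)`. -/
abbrev C1Circle : Type :=
  {u : C(UnitAddCircle, ℝ) // ContDiff ℝ 1 (fun t : ℝ => u (t : UnitAddCircle))}

/-- `H¹(𝕊¹; ℝ)`: the periodic absolutely continuous functions with derivative in `L²`. -/
abbrev H1Circle : Type :=
  {u : C(UnitAddCircle, ℝ) //
    AbsolutelyContinuousOnInterval (fun t : ℝ => u (t : UnitAddCircle)) 0 1 ∧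
      MemLp (circleDeriv u) 2 (volume : Measure UnitAddCircle)}

/-- `L²(𝕊¹; ℝ)`. -/
abbrev L2Circle : Type := Lp ℝ 2 (volume : Measure UnitAddCircle)

instance : Nonempty C1Circle := ⟨⟨0, by simpa using contDiff_const⟩⟩

instance : Nonempty H1Circle := by
  refine ⟨⟨0, ?_, ?_⟩⟩
  · have h : LipschitzOnWith 0 (fun _ : ℝ => (0 : ℝ)) (uIcc 0 1) :=
      (LipschitzWith.const (0 : ℝ)).lipschitzOnWith
    simpa using h.absolutelyContinuousOnInterval
  · have h : circleDeriv (0 : C(UnitAddCircle, ℝ)) = fun _ => (0 : ℝ) := by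
      funext x
      simp [circleDeriv]
    rw [h]
    exact memLp_const 0

/-- The operator `F : C¹ → C⁰`, `F(u)(t) = u'(t) + f(t, u(t))`. -/
noncomputable def opC (f : Nonlinearity) (u : C1Circle) : C(UnitAddCircle, ℝ) where
  toFun := odeOp f u.1
  continuous_toFun := by
    refine Continuous.add (continuous_of_lift ?_) (continuous_nemytskii f u.1)
    simp only [circleDeriv_coe]
    exact u.2.continuous_deriv le_rfl

theorem memLp_odeOp (f : Nonlinearity) (u : H1Circle) :
    MemLp (odeOp f u.1) 2 (volume : Measure UnitAddCircle) := by
  refine MemLp.add u.2.2 ?_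
  exact ContinuousMap.memLp volume ℝ (ContinuousMap.mk _ (continuous_nemytskii f u.1))

/-- The operator `F : H¹ → L²`, `F(u)(t) = u'(t) + f(t, u(t))`. -/
noncomputable def opH (f : Nonlinearity) (u : H1Circle) : L2Circle := (memLp_odeOp f u).toLp

/-! ### Adapted coordinates and the sets `S_k` -/

/-- The constant function `s`, as an element of `C⁰`. -/
noncomputable def constC (s : ℝ) : C(UnitAddCircle, ℝ) := ContinuousMap.const _ s

/-- The constant function `s`, as an element of `L²`. -/
noncomputable def constH (s : ℝ) : L2Circle := Lp.const 2 (volume : Measure UnitAddCircle) s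

/-- `Ψ : C¹ → C⁰`: the sum of the part of average zero of `F(u)` and the average of `u`. -/
noncomputable def psiC (f : Nonlinearity) (u : C1Circle) : C(UnitAddCircle, ℝ) :=
  opC f u - constC (mean (opC f u)) + constC (mean u.1)

/-- `Ψ : H¹ → L²`: the sum of the part of average zero of `F(u)` and the average of `u`. -/
noncomputable def psiH (f : Nonlinearity) (u : H1Circle) : L2Circle :=
  opH f u - constH (mean (opH f u)) + constH (mean u.1)

/-- `φ(z)` is the average of `F(Ψ⁻¹(z))`, so that `F ∘ Ψ⁻¹` is `(ṽ, ū) ↦ (ṽ, φ(ṽ, ū))`.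
It is meaningful for `z` in the image of the (injective) map `Ψ`. -/
noncomputable def phiC (f : Nonlinearity) (z : C(UnitAddCircle, ℝ)) : ℝ :=
  mean (opC f (Function.invFun (psiC f) z))

/-- The same function `φ` for the spaces `H¹` and `L²`. -/
noncomputable def phiH (f : Nonlinearity) (z : L2Circle) : ℝ :=
  mean (opH f (Function.invFun (psiH f) z))

/-- `S_k ⊆ C¹`: the points at which `D₂φ = ⋯ = D₂ᵏφ = 0` in adapted coordinates, where `D₂` is
the derivative in the direction of the constant functions. -/
def stratumC (f : Nonlinearity) (k : ℕ) : Set C1Circle :=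
  {u | ∀ i : ℕ, 1 ≤ i → i ≤ k → iteratedDeriv i (fun s : ℝ => phiC f (psiC f u + constC s)) 0 = 0}

/-- `S_k ⊆ H¹`. -/
def stratumH (f : Nonlinearity) (k : ℕ) : Set H1Circle :=
  {u | ∀ i : ℕ, 1 ≤ i → i ≤ k → iteratedDeriv i (fun s : ℝ => phiH f (psiH f u + constH s)) 0 = 0}

/-! ### The return map -/

/-- `w : [0,1] → ℝ` is a classical solution of `w'(t) + f(t, w(t)) = v(t)`, for continuous `v`.
Only the values of `w` on `[0,1]` matter. -/
def IsSolutionC (f : Nonlinearity) (v : C(UnitAddCircle, ℝ)) (w : ℝ → ℝ) : Prop :=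
  ∀ t ∈ Icc (0 : ℝ) 1, HasDerivWithinAt w (v t - f t (w t)) (Icc 0 1) t

/-- `w : [0,1] → ℝ` is a (Carathéodory) solution of `w'(t) + f(t, w(t)) = v(t)`, for `v ∈ L²`:
it is absolutely continuous and satisfies the equation almost everywhere.
Only the values of `w` on `[0,1]` matter. -/
def IsSolutionH (f : Nonlinearity) (v : L2Circle) (w : ℝ → ℝ) : Prop :=
  AbsolutelyContinuousOnInterval w 0 1 ∧
    ∀ᵐ t : ℝ ∂(volume.restrict (Icc (0 : ℝ) 1)), HasDerivAt w (v ((t : ℝ) : UnitAddCircle) - f t (w t)) t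

/-- The maximal domain `I`: the initial conditions whose solution extends to `t = 1`. -/
def returnDomain (sol : (ℝ → ℝ) → Prop) : Set ℝ := {c | ∃ w, sol w ∧ w 0 = c}

open Classical in
/-- The return map `w(0) ↦ w(1)`, with the value `0` outside its domain `I`. -/
noncomputable def returnMap (sol : (ℝ → ℝ) → Prop) (c : ℝ) : ℝ :=
  if h : ∃ w, sol w ∧ w 0 = c then h.choose 1 else 0

/-! ### Orders -/

/-- The largest `k` with `u ∈ S k` (possibly infinite). -/
noncomputable def stratumOrder {X : Type} (S : ℕ → Set X) (u : X) : ℕ∞ :=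
  ⨆ k ∈ {k : ℕ | u ∈ S k}, (k : ℕ∞)

/-- The order of contact at `x` of two functions smooth near `x` that agree at `x`: the largest
`k` such that their derivatives at `x` of all orders `i ≤ k` agree (possibly infinite). -/
noncomputable def contactOrder (g h : ℝ → ℝ) (x : ℝ) : ℕ∞ :=
  ⨆ k ∈ {k : ℕ | ∀ i ≤ k, iteratedDeriv i g x = iteratedDeriv i h x}, (k : ℕ∞)

end PeriodicODE

/-!
If `w` solves `w' + f(t, w) = F(u) + l`, then `y = w - u` solves `y' = g(t, y) + l` with
`g(t, y) = f(t, u(t)) - f(t, u(t) + y)`, so that `g(t, 0) = 0`. The inverse function theorem,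
applied to the integral equation in `C([0, 1])`, shows that the solutions near `0` form a smooth
family in `(y(0), l)`. Let `P(c, l) = y(1) - y(0)` for the solution with `y(0) = c`.

Then `P(c, 0) = ρ_v(u(0) + c) - (u(0) + c)`, while the `1`-periodic solutions are the zeros of `P`.
These form a smooth curve `(c(s), L(s))`, parametrized by the average `s` of `y`, with `c'(0) ≠ 0`
and `φ(Ψ(u) + s) = ∫ F(u) + L(s)`. Since `P(c(s), L(s)) = 0` and `∂P/∂l ≠ 0`, the quantities
`P(c(s), 0)` and `L(s)` are comparable, so `P(·, 0)` and `L` vanish to the same order at `0`.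
-/

namespace PeriodicODE

section OrderOfVanishing

open Asymptotics Filter

variable {g : ℝ → ℝ} {x₀ : ℝ}

theorem taylor_isLittleO_nhds {k : ℕ} (hg : ContDiffAt ℝ k g x₀) :
    (fun x => g x - ∑ i ∈ Finset.range (k + 1),
      (i.factorial : ℝ)⁻¹ * (x - x₀) ^ i * iteratedDeriv i g x₀)
      =o[𝓝 x₀] fun x => (x - x₀) ^ k := by
  obtain ⟨U, hU, hgU⟩ := hg.contDiffOn le_rfl (by simp)
  obtain ⟨r, hr, hrU⟩ := Metric.mem_nhds_iff.1 hU
  have hx : x₀ ∈ Metric.ball x₀ r := Metric.mem_ball_self hr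
  have h := taylor_isLittleO (convex_ball x₀ r) hx (hgU.mono hrU)
  rw [Metric.isOpen_ball.nhdsWithin_eq hx] at h
  simpa only [taylor_within_apply, iteratedDerivWithin_of_isOpen Metric.isOpen_ball hx,
    smul_eq_mul] using h

theorem iteratedDeriv_eq_zero_of_isLittleO {k : ℕ} (hg : ContDiffAt ℝ k g x₀)
    (hlow : ∀ i < k, iteratedDeriv i g x₀ = 0) (h : g =o[𝓝 x₀] fun x => (x - x₀) ^ k) :
    iteratedDeriv k g x₀ = 0 := by
  have hmono : (fun x => (x - x₀) ^ k * ((k.factorial : ℝ)⁻¹ * iteratedDeriv k g x₀))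
      =o[𝓝[≠] x₀] fun x => (x - x₀) ^ k := by
    refine ((h.sub (taylor_isLittleO_nhds hg)).mono nhdsWithin_le_nhds).congr_left fun x => ?_
    rw [Finset.sum_range_succ, Finset.sum_eq_zero fun i hi => by
      rw [hlow i (Finset.mem_range.1 hi), mul_zero]]
    ring
  have hcoeff : (k.factorial : ℝ)⁻¹ * iteratedDeriv k g x₀ = 0 := by
    refine tendsto_nhds_unique_of_eventuallyEq tendsto_const_nhds hmono.tendsto_div_nhds_zero ?_
    filter_upwards [self_mem_nhdsWithin] with x hx
    rw [mul_div_cancel_left₀ _ (pow_ne_zero _ (sub_ne_zero.2 hx))]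
  exact (mul_eq_zero.1 hcoeff).resolve_left (by positivity)

theorem iteratedDeriv_eq_zero_iff_isLittleO {k : ℕ} (hg : ContDiffAt ℝ k g x₀) :
    (∀ i ≤ k, iteratedDeriv i g x₀ = 0) ↔ g =o[𝓝 x₀] fun x => (x - x₀) ^ k := by
  refine ⟨fun h => (taylor_isLittleO_nhds hg).congr_left fun x => ?_, fun h i => ?_⟩
  · rw [Finset.sum_eq_zero fun i hi => by rw [h i (Finset.mem_range_succ_iff.1 hi), mul_zero],
      sub_zero]
  · induction i using Nat.strong_induction_on with
    | _ i ih =>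
      intro hik
      have hpow : (fun x => (x - x₀) ^ k) =O[𝓝 x₀] fun x => (x - x₀) ^ i := by
        rcases hik.eq_or_lt with rfl | hlt
        · exact isBigO_refl _ _
        · exact ((isLittleO_pow_pow hlt).comp_tendsto
            (tendsto_sub_nhds_zero_iff.2 tendsto_id)).isBigO
      exact iteratedDeriv_eq_zero_of_isLittleO (hg.of_le (mod_cast hik))
        (fun j hj => ih j hj (hj.le.trans hik)) (h.trans_isBigO hpow)

theorem isTheta_of_eventually_eq_zero {α : Type*} {m : Filter α} {P : ℝ × ℝ → ℝ}
    {P' : ℝ × ℝ →L[ℝ] ℝ} (hP : HasStrictFDerivAt P P' 0) (hP' : P' (0, 1) ≠ 0) {c l : α → ℝ}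
    (hc : Tendsto c m (𝓝 0)) (hl : Tendsto l m (𝓝 0)) (h : ∀ᶠ a in m, P (c a, l a) = 0) :
    (fun a => P (c a, 0)) =Θ[m] l := by
  have hlim : Tendsto (fun a => ((c a, 0), (c a, l a))) m (𝓝 ((0 : ℝ × ℝ), (0 : ℝ × ℝ))) :=
    (hc.prodMk_nhds tendsto_const_nhds).prodMk_nhds (hc.prodMk_nhds hl)
  have hlittle : (fun a => P (c a, 0) - -P' (0, 1) * l a) =o[m] l := by
    have hlin : ∀ x, P' (0, x) = P' (0, 1) * x := fun x => by
      rw [mul_comm, ← smul_eq_mul, ← map_smul, Prod.smul_mk, smul_zero, smul_eq_mul, mul_one]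
    refine ((hP.isLittleO.comp_tendsto hlim).congr' ?_ .rfl).trans_isBigO
      (.of_bound 1 (.of_forall fun a => ?_))
    · filter_upwards [h] with a ha
      rw [Function.comp_apply, ha, Prod.mk_sub_mk, sub_self, zero_sub, hlin]
      ring
    · simp only [Function.comp_apply, Prod.mk_sub_mk, sub_self, zero_sub, Prod.norm_mk, norm_zero,
        norm_neg, one_mul]
      exact (max_eq_right (norm_nonneg _)).le
  have hmul : (fun a => -P' (0, 1) * l a) =Θ[m] l :=
    (isTheta_rfl).const_mul_left (neg_ne_zero.2 hP')
  exact (IsEquivalent.isTheta (hlittle.trans_isTheta hmul.symm)).trans hmul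

theorem iteratedDeriv_eq_zero_iff_of_eventually_eq_zero {P : ℝ × ℝ → ℝ} {c l : ℝ → ℝ} {k : ℕ}
    (hP : ContDiffAt ℝ ∞ P 0) (hP' : fderiv ℝ P 0 (0, 1) ≠ 0)
    (hc : ContDiffAt ℝ ∞ c 0) (hc0 : c 0 = 0) (hc' : deriv c 0 ≠ 0)
    (hl : ContDiffAt ℝ ∞ l 0) (hl0 : l 0 = 0) (h : ∀ᶠ s in 𝓝 0, P (c s, l s) = 0) :
    (∀ i ≤ k, iteratedDeriv i (fun x => P (x, 0)) 0 = 0) ↔ ∀ i ≤ k, iteratedDeriv i l 0 = 0 := by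
  have hk : (k : ℕ∞ω) ≤ ∞ := mod_cast le_top
  have hPx : ContDiffAt ℝ ∞ (fun x => P (x, 0)) 0 :=
    hP.comp (f := fun x => (x, 0)) 0 (contDiffAt_id.prodMk contDiffAt_const)
  have hcs : HasStrictDerivAt c (deriv c 0) 0 := hc.hasStrictDerivAt (by simp)
  have hc_theta : c =Θ[𝓝 0] fun s => s := by
    have hlim : Tendsto (fun s : ℝ => (s, (0 : ℝ))) (𝓝 0) (𝓝 0 ×ˢ pure 0) :=
      tendsto_id.prodMk tendsto_const_pure
    obtain ⟨hO, hO'⟩ := hcs.hasDerivAt.isTheta_sub hc'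
    simpa only [IsTheta, Function.comp_def, hc0, sub_zero] using
      And.intro (hO.comp_tendsto hlim) (hO'.comp_tendsto hlim)
  have hl_theta : (fun s => P (c s, 0)) =Θ[𝓝 0] l :=
    isTheta_of_eventually_eq_zero (hP.hasStrictFDerivAt (by simp)) hP'
      (by simpa only [hc0] using hc.continuousAt.tendsto)
      (by simpa only [hl0] using hl.continuousAt.tendsto) h
  have hmap : map c (𝓝 0) = 𝓝 0 := by rw [hcs.map_nhds_eq hc', hc0]
  rw [iteratedDeriv_eq_zero_iff_isLittleO (hPx.of_le hk),
    iteratedDeriv_eq_zero_iff_isLittleO (hl.of_le hk)]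
  simp only [sub_zero]
  calc ((fun x => P (x, 0)) =o[𝓝 0] fun x => x ^ k)
      ↔ (fun s => P (c s, 0)) =o[𝓝 0] fun s => c s ^ k := by
        conv_lhs => rw [← hmap, isLittleO_map]
        rfl
    _ ↔ l =o[𝓝 0] fun s => s ^ k :=
        hl_theta.isLittleO_congr_left.trans (hc_theta.pow k).isLittleO_congr_right

theorem exists_smooth_rightInverse {E F : Type*} [NormedAddCommGroup E] [NormedSpace ℝ E]
    [CompleteSpace E] [NormedAddCommGroup F] [NormedSpace ℝ F] {n : ℕ∞ω} {Φ : E → F} {D : E ≃L[ℝ] F}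
    {x : E} (hn : n ≠ 0) (hΦ : ContDiffAt ℝ n Φ x) (hD : HasFDerivAt Φ (D : E →L[ℝ] F) x) :
    ∃ K : F → E, ContDiffAt ℝ n K (Φ x) ∧ K (Φ x) = x ∧
      HasFDerivAt K (D.symm : F →L[ℝ] E) (Φ x) ∧ ∀ᶠ y in 𝓝 (Φ x), Φ (K y) = y :=
  have hstrict := hΦ.hasStrictFDerivAt' hD hn
  ⟨hΦ.localInverse hD hn, hΦ.to_localInverse hD hn, hΦ.localInverse_apply_image hD hn,
    hstrict.to_localInverse.hasFDerivAt, hstrict.eventually_right_inverse⟩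

theorem exists_curve_of_injective_fderiv {H : ℝ × ℝ → ℝ × ℝ} (hH : ContDiffAt ℝ ∞ H 0)
    (hH0 : H 0 = 0) (hinj : Function.Injective (fderiv ℝ H 0))
    (hH' : (fderiv ℝ H 0 (0, 1)).1 ≠ 0) :
    ∃ c l : ℝ → ℝ, ContDiffAt ℝ ∞ c 0 ∧ ContDiffAt ℝ ∞ l 0 ∧ c 0 = 0 ∧ l 0 = 0 ∧ deriv c 0 ≠ 0 ∧
      ∀ᶠ s in 𝓝 0, H (c s, l s) = (0, s) := by
  let H' : (ℝ × ℝ) ≃L[ℝ] ℝ × ℝ :=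
    (LinearEquiv.ofInjectiveEndo (fderiv ℝ H 0 : ℝ × ℝ →ₗ[ℝ] ℝ × ℝ) hinj).toContinuousLinearEquiv
  have hderiv : HasFDerivAt H (H' : ℝ × ℝ →L[ℝ] ℝ × ℝ) 0 :=
    (hH.differentiableAt (by simp)).hasFDerivAt
  obtain ⟨K, hK, hK0, hK', hHK⟩ := exists_smooth_rightInverse (by simp) hH hderiv
  rw [hH0] at hK hK0 hK' hHK
  have hsmooth : ContDiffAt ℝ ∞ (fun s => K (0, s)) 0 :=
    hK.comp (0 : ℝ) (contDiffAt_const.prodMk contDiffAt_id)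
  have hderiv_fst : HasDerivAt (fun s => (K (0, s)).1) (H'.symm (0, 1)).1 0 :=
    (ContinuousLinearMap.fst ℝ ℝ ℝ).hasFDerivAt.comp_hasDerivAt (0 : ℝ)
      (hK'.comp_hasDerivAt (0 : ℝ) ((hasDerivAt_const 0 0).prodMk (hasDerivAt_id 0)))
  have hlim : Tendsto (fun s : ℝ => ((0 : ℝ), s)) (𝓝 0) (𝓝 0) :=
    Continuous.tendsto' (by fun_prop) _ _ rfl
  refine ⟨fun s => (K (0, s)).1, fun s => (K (0, s)).2, hsmooth.fst, hsmooth.snd,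
    congrArg Prod.fst hK0, congrArg Prod.snd hK0, fun h0 => ?_, hlim.eventually hHK⟩
  rw [hderiv_fst.deriv] at h0
  obtain ⟨q, hq⟩ : ∃ q, H'.symm (0, 1) = (0, q) := ⟨_, Prod.ext h0 rfl⟩
  have hH'q : H' (q • (0, 1)) = (0, 1) := by
    rw [Prod.smul_mk, smul_zero, smul_eq_mul, mul_one, ← hq, H'.apply_symm_apply]
  rw [map_smul] at hH'q
  rcases mul_eq_zero.1 (congrArg Prod.fst hH'q) with hq0 | h10
  · simpa [hq0] using congrArg Prod.snd hH'q
  · exact hH' h10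

end OrderOfVanishing

section LinearEquation

variable {a b : ℝ → ℝ}

theorem continuous_exp_neg_integral (ha : Continuous a) :
    Continuous fun t => Real.exp (-∫ τ in 0..t, a τ) :=
  (intervalIntegral.continuous_primitive (fun _ _ => ha.intervalIntegrable _ _) 0).neg.rexp

/-- Variation of constants: the solution of `d' = a d + b` with `d 0 = c`. -/
noncomputable def linearSolution (a b : ℝ → ℝ) (c t : ℝ) : ℝ :=
  Real.exp (∫ τ in 0..t, a τ) * (c + ∫ τ in 0..t, Real.exp (-∫ σ in 0..τ, a σ) * b τ)

theorem linearSolution_zero (c : ℝ) : linearSolution a b c 0 = c := by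
  simp [linearSolution]

theorem hasDerivAt_linearSolution (ha : Continuous a) (hb : Continuous b) (c t : ℝ) :
    HasDerivAt (linearSolution a b c) (a t * linearSolution a b c t + b t) t := by
  have hA : ∀ t, HasDerivAt (fun t => ∫ τ in 0..t, a τ) (a t) t :=
    fun t => (ha.integral_hasStrictDerivAt 0 t).hasDerivAt
  have hB := (((continuous_exp_neg_integral ha).mul hb).integral_hasStrictDerivAt 0 t).hasDerivAt
  refine ((hA t).exp.mul (hB.const_add c)).congr_deriv ?_
  simp only [Pi.mul_apply]
  rw [← mul_assoc, ← Real.exp_add, add_neg_cancel, Real.exp_zero, linearSolution]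
  ring

theorem eqOn_zero_of_isIntegralCurveOn_linear {d : ℝ → ℝ} (ha : Continuous a)
    (hd : IsIntegralCurveOn d (fun t x => a t * x) (Icc 0 1)) (h0 : d 0 = 0) :
    EqOn d 0 (Icc 0 1) := by
  have hE : ∀ t, HasDerivAt (fun t => Real.exp (-∫ τ in 0..t, a τ))
      (Real.exp (-∫ τ in 0..t, a τ) * -a t) t :=
    fun t => (ha.integral_hasStrictDerivAt 0 t).hasDerivAt.neg.exp
  have hderiv : ∀ t ∈ Icc (0 : ℝ) 1,
      HasDerivWithinAt (fun t => Real.exp (-∫ τ in 0..t, a τ) * d t) 0 (Icc 0 1) t := fun t ht =>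
    ((hE t).hasDerivWithinAt.mul (hd t ht)).congr_deriv (by ring)
  intro t ht
  have hconst := constant_of_derivWithin_zero (fun s hs => (hderiv s hs).differentiableWithinAt)
    (fun s hs => (hderiv s (Ico_subset_Icc_self hs)).derivWithin
      (uniqueDiffOn_Icc one_pos s (Ico_subset_Icc_self hs))) t ht
  simpa [h0, Real.exp_ne_zero] using hconst

theorem eqOn_linearSolution {d : ℝ → ℝ} (ha : Continuous a) (hb : Continuous b)
    (hd : IsIntegralCurveOn d (fun t x => a t * x + b t) (Icc 0 1)) :
    EqOn d (linearSolution a b (d 0)) (Icc 0 1) := by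
  have hsub : IsIntegralCurveOn (d - linearSolution a b (d 0)) (fun t x => a t * x) (Icc 0 1) :=
    fun t ht => ((hd t ht).sub (hasDerivAt_linearSolution ha hb _ t).hasDerivWithinAt).congr_deriv
      (by simp only [Pi.sub_apply]; ring)
  have hzero := eqOn_zero_of_isIntegralCurveOn_linear ha hsub (by simp [linearSolution_zero])
  exact fun t ht => sub_eq_zero.1 (hzero ht)

theorem eq_zero_of_periodic_of_exists_zero {d : ℝ → ℝ} {l : ℝ} (ha : Continuous a)
    (hd : IsIntegralCurveOn d (fun t x => a t * x + l) (Icc 0 1)) (hper : d 1 = d 0)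
    (hzero : ∃ t ∈ Icc (0 : ℝ) 1, d t = 0) : l = 0 ∧ EqOn d 0 (Icc 0 1) := by
  let Q : ℝ → ℝ := fun t => ∫ τ in 0..t, Real.exp (-∫ σ in 0..τ, a σ)
  have hQ : StrictMono Q := strictMono_of_hasDerivAt_pos
    (fun t => ((continuous_exp_neg_integral ha).integral_hasStrictDerivAt 0 t).hasDerivAt)
    fun t => Real.exp_pos _
  have hQ0 : Q 0 = 0 := intervalIntegral.integral_same
  have hformula : ∀ t ∈ Icc (0 : ℝ) 1, d t = Real.exp (∫ τ in 0..t, a τ) * (d 0 + l * Q t) := by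
    intro t ht
    rw [eqOn_linearSolution ha continuous_const hd ht, linearSolution,
      intervalIntegral.integral_mul_const, mul_comm l]
  obtain ⟨t₀, ht₀, hdt₀⟩ := hzero
  have hd0 : d 0 = -(l * Q t₀) := by
    rw [hformula t₀ ht₀, mul_eq_zero, or_iff_right (Real.exp_ne_zero _)] at hdt₀
    linarith
  have hl : l = 0 := by
    have h1 := hformula 1 (right_mem_Icc.2 zero_le_one)
    rw [hper, hd0] at h1
    have hfactor : l * (Real.exp (∫ τ in 0..1, a τ) * (Q 1 - Q t₀) + Q t₀) = 0 := by linarith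
    have hQt₀ : 0 ≤ Q t₀ := hQ0 ▸ hQ.monotone ht₀.1
    have hQ1 : 0 ≤ Q 1 - Q t₀ := sub_nonneg.2 (hQ.monotone ht₀.2)
    have hpos : 0 < Q 1 := hQ0 ▸ hQ zero_lt_one
    refine (mul_eq_zero.1 hfactor).resolve_right (ne_of_gt ?_)
    rcases hQt₀.eq_or_lt with h | h
    · rw [← h, sub_zero, add_zero]
      positivity
    · positivity
  refine ⟨hl, fun t ht => ?_⟩
  rw [hformula t ht, hd0, hl, zero_mul, zero_mul, neg_zero, add_zero, mul_zero, Pi.zero_apply]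

end LinearEquation

section Superposition

variable {X E : Type*} [TopologicalSpace X] [NormedAddCommGroup E] {g : E × ℝ → ℝ}

/-- The superposition (Nemytskii) operator `y ↦ g(ξ(·), y(·))`; the dependence on the base point is
carried by the continuous map `ξ`, so that `g` can be taken smooth in all its variables. -/
def superposition (hg : Continuous g) (ξ : C(X, E)) (y : C(X, ℝ)) : C(X, ℝ) :=
  ⟨fun t => g (ξ t, y t), by fun_prop⟩

theorem superposition_apply (hg : Continuous g) (ξ : C(X, E)) (y : C(X, ℝ)) (t : X) :
    superposition hg ξ y t = g (ξ t, y t) := rfl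

variable [LocallyCompactPair X ℝ]

theorem continuous_superposition (hg : Continuous g) (ξ : C(X, E)) :
    Continuous (superposition hg ξ) :=
  ContinuousMap.continuous_of_continuous_uncurry _ (by
    simp only [Function.uncurry_def, superposition_apply]; fun_prop)

variable [NormedSpace ℝ E]

/-- The partial derivative in the second variable. -/
noncomputable def partialSnd (g : E × ℝ → ℝ) (p : E × ℝ) : ℝ := fderiv ℝ g p (0, 1)

theorem contDiff_partialSnd (hg : ContDiff ℝ ∞ g) : ContDiff ℝ ∞ (partialSnd g) :=
  (hg.fderiv_right (m := ∞) (by simp)).clm_apply contDiff_const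

theorem hasDerivAt_partialSnd (hg : ContDiff ℝ ∞ g) (x : E) (y : ℝ) :
    HasDerivAt (fun y => g (x, y)) (partialSnd g (x, y)) y :=
  (hg.differentiable (by simp) (x, y)).hasFDerivAt.comp_hasDerivAt y
    ((hasDerivAt_const y x).prodMk (hasDerivAt_id y))

theorem norm_sub_sub_partialSnd_mul_le (hg : ContDiff ℝ ∞ g) {x : E} {y k ε : ℝ}
    (hε : ∀ z ∈ Metric.closedBall y ‖k‖, ‖partialSnd g (x, z) - partialSnd g (x, y)‖ ≤ ε) :
    ‖g (x, y + k) - g (x, y) - partialSnd g (x, y) * k‖ ≤ ε * ‖k‖ := by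
  have hmean := (convex_closedBall y ‖k‖).norm_image_sub_le_of_norm_hasDerivWithin_le
    (fun z _ => ((hasDerivAt_partialSnd hg x z).sub
      (hasDerivAt_const_mul (partialSnd g (x, y)))).hasDerivWithinAt)
    hε (x := y) (y := y + k) (by simp) (by simp)
  rw [add_sub_cancel_left] at hmean
  refine (congrArg norm ?_).trans_le hmean
  simp only [Pi.sub_apply]
  ring

theorem hasFDerivAt_superposition [CompactSpace X] (hg : ContDiff ℝ ∞ g) (ξ : C(X, E))
    (y : C(X, ℝ)) :
    HasFDerivAt (superposition hg.continuous ξ) (ContinuousLinearMap.mul ℝ C(X, ℝ)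
      (superposition (contDiff_partialSnd hg).continuous ξ y)) y := by
  set N := superposition (contDiff_partialSnd hg).continuous ξ
  rw [hasFDerivAt_iff_isLittleO_nhds_zero, Asymptotics.isLittleO_iff]
  intro ε hε
  obtain ⟨δ, hδ, hN⟩ := Metric.continuousAt_iff.1
    (continuous_superposition (contDiff_partialSnd hg).continuous ξ).continuousAt ε hε
  filter_upwards [Metric.ball_mem_nhds 0 hδ] with k hk
  rw [mem_ball_zero_iff] at hk
  refine (ContinuousMap.norm_le _ (by positivity)).2 fun t => ?_
  have hkt : ‖k t‖ ≤ ‖k‖ := k.norm_coe_le_norm t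
  -- A value `z` near `y t` is the value at `t` of a translate of `y`, which is uniformly near `y`.
  have hbound : ∀ z ∈ Metric.closedBall (y t) ‖k t‖,
      ‖partialSnd g (ξ t, z) - partialSnd g (ξ t, y t)‖ ≤ ε := by
    intro z hz
    set y' : C(X, ℝ) := y + ContinuousMap.const X (z - y t)
    have hdist : dist y' y < δ := by
      rw [dist_eq_norm, add_sub_cancel_left]
      exact ((ContinuousMap.norm_le _ (norm_nonneg _)).2 fun _ => mem_closedBall_iff_norm.1 hz
        ).trans_lt (hkt.trans_lt hk)
    have hval : (N y' - N y) t = partialSnd g (ξ t, z) - partialSnd g (ξ t, y t) := by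
      simp [N, y', superposition_apply]
    rw [← hval]
    exact ((N y' - N y).norm_coe_le_norm t).trans (dist_eq_norm (N y') (N y) ▸ (hN hdist).le)
  exact (norm_sub_sub_partialSnd_mul_le hg hbound).trans (mul_le_mul_of_nonneg_left hkt hε.le)

theorem contDiff_superposition [CompactSpace X] (hg : ContDiff ℝ ∞ g) (ξ : C(X, E)) :
    ContDiff ℝ ∞ (superposition hg.continuous ξ) := by
  refine contDiff_infty.2 fun n => ?_
  induction n generalizing g with
  | zero => exact contDiff_zero.2 (continuous_superposition _ _)
  | succ n ih =>
    have hmul : ContDiff ℝ n fun a : C(X, ℝ) => ContinuousLinearMap.mul ℝ C(X, ℝ) a := by fun_prop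
    exact contDiff_succ_iff_hasFDerivAt.2
      ⟨_, hmul.comp (ih (contDiff_partialSnd hg)), hasFDerivAt_superposition hg ξ⟩

theorem exists_continuous_divided_difference (hg : ContDiff ℝ ∞ g) {ξ : ℝ → E} {x y : ℝ → ℝ}
    (hξ : Continuous ξ) (hx : Continuous x) (hy : Continuous y) :
    ∃ a : ℝ → ℝ, Continuous a ∧ ∀ t, g (ξ t, y t) - g (ξ t, x t) = a t * (y t - x t) := by
  have hc : Continuous (partialSnd g) := (contDiff_partialSnd hg).continuous
  refine ⟨fun t => ∫ θ in (0 : ℝ)..1, partialSnd g (ξ t, x t + θ * (y t - x t)),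
    intervalIntegral.continuous_parametric_intervalIntegral_of_continuous' (by fun_prop) _ _,
    fun t => ?_⟩
  have hderiv : ∀ θ : ℝ, HasDerivAt (fun θ => g (ξ t, x t + θ * (y t - x t)))
      (partialSnd g (ξ t, x t + θ * (y t - x t)) * (y t - x t)) θ := fun θ =>
    (hasDerivAt_partialSnd hg (ξ t) _).comp θ
      ((hasDerivAt_mul_const (y t - x t)).const_add (x t))
  have hint := intervalIntegral.integral_eq_sub_of_hasDerivAt (a := 0) (b := 1)
    (fun θ _ => hderiv θ) ((by fun_prop : Continuous _).intervalIntegrable _ _)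
  rw [intervalIntegral.integral_mul_const] at hint
  rw [hint]
  simp

end Superposition

section Volterra

/-- The Banach space `C([0, 1])`. -/
abbrev CInterval : Type := C(Icc (0 : ℝ) 1, ℝ)

/-- The extension of a function on `[0, 1]` to the line by its boundary values. -/
noncomputable def extend (y : CInterval) : ℝ → ℝ := IccExtend zero_le_one y

theorem continuous_extend (y : CInterval) : Continuous (extend y) := y.continuous.Icc_extend'

theorem extend_of_mem (y : CInterval) {t : ℝ} (ht : t ∈ Icc (0 : ℝ) 1) :
    extend y t = y ⟨t, ht⟩ :=
  IccExtend_of_mem _ _ ht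

theorem continuous_integral_extend (y : CInterval) : Continuous fun t => ∫ τ in 0..t, extend y τ :=
  intervalIntegral.continuous_primitive (fun _ _ => (continuous_extend y).intervalIntegrable _ _) 0

/-- The Volterra operator: the primitive vanishing at `0`. -/
noncomputable def volterra : CInterval →L[ℝ] CInterval :=
  LinearMap.mkContinuous
    { toFun := fun y => ⟨fun t => ∫ τ in (0 : ℝ)..t, extend y τ,
        (continuous_integral_extend y).comp continuous_subtype_val⟩
      map_add' := fun y z => ContinuousMap.ext fun t =>
        intervalIntegral.integral_add ((continuous_extend y).intervalIntegrable 0 t)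
          ((continuous_extend z).intervalIntegrable 0 t)
      map_smul' := fun c y => ContinuousMap.ext fun t =>
        intervalIntegral.integral_const_mul (a := 0) (b := t) c (extend y) } 1 (by
    intro y
    rw [one_mul, ContinuousMap.norm_le _ (norm_nonneg _)]
    intro t
    refine (intervalIntegral.norm_integral_le_of_norm_le_const
      fun τ _ => y.norm_coe_le_norm _).trans ?_
    rw [sub_zero, abs_of_nonneg t.2.1]
    exact mul_le_of_le_one_right (norm_nonneg _) t.2.2)

theorem volterra_apply (y : CInterval) (t : Icc (0 : ℝ) 1) :
    volterra y t = ∫ τ in (0 : ℝ)..t, extend y τ := rfl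

theorem eq_const_add_volterra_iff {y z : CInterval} {c : ℝ} :
    y = ContinuousMap.const _ c + volterra z ↔
      y 0 = c ∧ ∀ t ∈ Icc (0 : ℝ) 1, HasDerivWithinAt (extend y) (extend z t) (Icc 0 1) t := by
  constructor
  · rintro rfl
    refine ⟨by simp [volterra_apply], fun t ht => ?_⟩
    have hderiv : HasDerivAt (fun t => c + ∫ τ in 0..t, extend z τ) (extend z t) t :=
      ((continuous_extend z).integral_hasStrictDerivAt 0 t).hasDerivAt.const_add c
    exact hderiv.hasDerivWithinAt.congr_of_mem (fun s hs => extend_of_mem _ hs) ht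
  · rintro ⟨rfl, hy⟩
    ext ⟨t, ht⟩
    have hftc := intervalIntegral.integral_eq_sub_of_hasDerivAt_of_le ht.1
      (continuous_extend y).continuousOn
      (fun s hs => (hy s ⟨hs.1.le, hs.2.le.trans ht.2⟩).hasDerivAt
        (Icc_mem_nhds hs.1 (hs.2.trans_le ht.2)))
      ((continuous_extend z).intervalIntegrable _ _)
    rw [extend_of_mem y ht, extend_of_mem y (left_mem_Icc.2 zero_le_one)] at hftc
    simp only [ContinuousMap.add_apply, ContinuousMap.const_apply, volterra_apply, hftc]
    exact (add_sub_cancel _ _).symm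

/-- The data `(c, l)` of the problem `y' = h(t, y) + l`, `y 0 = c` in its integral form
`y - ∫ h(τ, y(τ)) dτ = c + l t`. -/
noncomputable def affineData : ℝ × ℝ →L[ℝ] CInterval :=
  (ContinuousLinearMap.fst ℝ ℝ ℝ).smulRight 1 +
    (ContinuousLinearMap.snd ℝ ℝ ℝ).smulRight (volterra 1)

theorem sub_volterra_eq_affineData_iff {y z : CInterval} {p : ℝ × ℝ} :
    y - volterra z = affineData p ↔ y 0 = p.1 ∧
      ∀ t ∈ Icc (0 : ℝ) 1, HasDerivWithinAt (extend y) (extend z t + p.2) (Icc 0 1) t := by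
  have hdata : affineData p + volterra z =
      ContinuousMap.const _ p.1 + volterra (z + ContinuousMap.const _ p.2) := by
    have hconst (c : ℝ) : ContinuousMap.const (Icc (0 : ℝ) 1) c = c • 1 := by ext; simp
    rw [hconst, hconst, map_add, map_smul]
    simp only [affineData, _root_.add_apply, ContinuousLinearMap.smulRight_apply,
      ContinuousLinearMap.coe_fst', ContinuousLinearMap.coe_snd']
    abel
  rw [sub_eq_iff_eq_add, hdata, eq_const_add_volterra_iff]
  rfl

theorem sub_volterra_mul_eq_affineData_iff {a y : CInterval} {p : ℝ × ℝ} :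
    y - volterra (a * y) = affineData p ↔ y 0 = p.1 ∧
      IsIntegralCurveOn (extend y) (fun t x => extend a t * x + p.2) (Icc 0 1) :=
  sub_volterra_eq_affineData_iff

theorem bijective_id_sub_volterra_mul (a : CInterval) :
    Function.Bijective (ContinuousLinearMap.id ℝ CInterval -
      volterra.comp (ContinuousLinearMap.mul ℝ CInterval a)) := by
  constructor
  · refine (injective_iff_map_eq_zero _).2 fun y hy => ?_
    rw [← map_zero affineData] at hy
    obtain ⟨hy0, hcurve⟩ := sub_volterra_mul_eq_affineData_iff.1 hy
    simp only [Prod.snd_zero, add_zero] at hcurve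
    have hzero := eqOn_zero_of_isIntegralCurveOn_linear (continuous_extend a) hcurve
      ((extend_of_mem y (left_mem_Icc.2 zero_le_one)).trans hy0)
    ext ⟨t, ht⟩
    exact (extend_of_mem y ht).symm.trans (hzero ht)
  · intro z
    -- `y = z + d` solves `y - V(a y) = z` as soon as `d' = a d + a z` and `d 0 = 0`.
    have hd := hasDerivAt_linearSolution (continuous_extend a) (continuous_extend (a * z)) 0
    let d : CInterval := ⟨fun t => linearSolution (extend a) (extend (a * z)) 0 t,
      (continuous_iff_continuousAt.2 fun t => (hd t).continuousAt).comp continuous_subtype_val⟩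
    have hd_eq : d = volterra (a * (z + d)) := by
      rw [← zero_add (volterra _)]
      refine eq_const_add_volterra_iff.2 ⟨linearSolution_zero 0, fun t ht => ?_⟩
      refine ((hd t).hasDerivWithinAt.congr_of_mem (fun s hs => extend_of_mem d hs) ht).congr_deriv
        ?_
      simp only [extend_of_mem _ ht, ContinuousMap.mul_apply, ContinuousMap.add_apply]
      exact (add_comm _ _).trans (mul_add _ _ _).symm
    exact ⟨z + d, sub_eq_iff_eq_add.2 (congrArg (z + ·) hd_eq)⟩

end Volterra

section SmoothFamily

variable {E : Type*} [NormedAddCommGroup E] [NormedSpace ℝ E] {g : E × ℝ → ℝ} {ξ : ℝ → E}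

theorem exists_smooth_family (hg : ContDiff ℝ ∞ g) (hξ : Continuous ξ) (h0 : ∀ t, g (ξ t, 0) = 0) :
    ∃ (Y : ℝ × ℝ → CInterval) (a : ℝ → ℝ), ContDiffAt ℝ ∞ Y 0 ∧ Y 0 = 0 ∧ Continuous a ∧
      (∀ᶠ p in 𝓝 0, Y p 0 = p.1 ∧
        IsIntegralCurveOn (extend (Y p)) (fun t x => g (ξ t, x) + p.2) (Icc 0 1)) ∧
      ∀ p, fderiv ℝ Y 0 p 0 = p.1 ∧
        IsIntegralCurveOn (extend (fderiv ℝ Y 0 p)) (fun t x => a t * x + p.2) (Icc 0 1) := by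
  let ξ' : C(Icc (0 : ℝ) 1, E) := ⟨fun t => ξ t, hξ.comp continuous_subtype_val⟩
  let a := superposition (contDiff_partialSnd hg).continuous ξ' 0
  let Φ (y : CInterval) := y - volterra (superposition hg.continuous ξ' y)
  let D : CInterval ≃L[ℝ] CInterval := ContinuousLinearEquiv.ofBijective
    (ContinuousLinearMap.id ℝ CInterval - volterra.comp (ContinuousLinearMap.mul ℝ CInterval a))
    (LinearMap.ker_eq_bot.2 (bijective_id_sub_volterra_mul a).1)
    (LinearMap.range_eq_top.2 (bijective_id_sub_volterra_mul a).2)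
  have hΦ : ContDiff ℝ ∞ Φ :=
    contDiff_id.sub (volterra.contDiff.comp (contDiff_superposition hg ξ'))
  have hΦ0 : Φ 0 = affineData 0 := by
    have hN : superposition hg.continuous ξ' 0 = 0 := by ext t; exact h0 t
    simp only [Φ, hN, map_zero, sub_zero]
  have hD : HasFDerivAt Φ (D : CInterval →L[ℝ] CInterval) 0 :=
    (hasFDerivAt_id 0).sub (volterra.hasFDerivAt.comp 0 (hasFDerivAt_superposition hg ξ' 0))
  obtain ⟨K, hK, hK0, hK', hΦK⟩ := exists_smooth_rightInverse (by simp) hΦ.contDiffAt hD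
  rw [hΦ0] at hK hK0 hK' hΦK
  have hY' : fderiv ℝ (K ∘ affineData) 0 = (D.symm : CInterval →L[ℝ] CInterval).comp affineData :=
    (hK'.comp 0 affineData.hasFDerivAt).fderiv
  refine ⟨K ∘ affineData, extend a, hK.comp 0 affineData.contDiff.contDiffAt, hK0,
    continuous_extend a, ?_, fun p => ?_⟩
  · filter_upwards [affineData.continuous.continuousAt.eventually hΦK] with p hp
    have hp' := sub_volterra_eq_affineData_iff.1 hp
    refine ⟨hp'.1, fun t ht => (hp'.2 t ht).congr_deriv ?_⟩
    simp only [extend_of_mem _ ht, superposition_apply]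
    rfl
  · rw [hY']
    exact sub_volterra_mul_eq_affineData_iff.1 (D.apply_symm_apply (affineData p))

end SmoothFamily

section ReturnAndPeriodic

variable {E : Type*} [NormedAddCommGroup E] [NormedSpace ℝ E] {g : E × ℝ → ℝ} {ξ : ℝ → E}

theorem exists_zero_of_integral_eq_zero {y : ℝ → ℝ} (hy : ContinuousOn y (Icc 0 1))
    (hint : ∫ τ in (0 : ℝ)..1, y τ = 0) : ∃ t ∈ Icc (0 : ℝ) 1, y t = 0 := by
  obtain ⟨t, ht, hyt⟩ := exists_eq_interval_average zero_ne_one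
    (hy.mono (uIcc_of_le zero_le_one).subset)
  rw [interval_average_eq, hint, smul_zero] at hyt
  exact ⟨t, uIoo_subset_uIcc_self.trans (uIcc_of_le zero_le_one).subset ht, hyt⟩

/-- The increment and the integral of a function on `[0, 1]`: the first component vanishes on the
functions with `y 1 = y 0`, and the second component is the average of these. -/
noncomputable def incrementIntegral : CInterval →L[ℝ] ℝ × ℝ :=
  ContinuousLinearMap.prod (ContinuousMap.evalCLM ℝ 1 - ContinuousMap.evalCLM ℝ 0)
    ((ContinuousMap.evalCLM ℝ 1).comp volterra)

theorem incrementIntegral_apply (y : CInterval) :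
    incrementIntegral y = (extend y 1 - extend y 0, ∫ τ in (0 : ℝ)..1, extend y τ) := by
  rw [extend_of_mem y (left_mem_Icc.2 zero_le_one), extend_of_mem y (right_mem_Icc.2 zero_le_one)]
  rfl

theorem exists_increment_integral_family (hg : ContDiff ℝ ∞ g) (hξ : Continuous ξ)
    (h0 : ∀ t, g (ξ t, 0) = 0) :
    ∃ H : ℝ × ℝ → ℝ × ℝ, ContDiffAt ℝ ∞ H 0 ∧ H 0 = 0 ∧ Function.Injective (fderiv ℝ H 0) ∧
      (fderiv ℝ H 0 (0, 1)).1 ≠ 0 ∧ ∀ᶠ p in 𝓝 0, ∃ y : ℝ → ℝ,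
        IsIntegralCurveOn y (fun t x => g (ξ t, x) + p.2) (Icc 0 1) ∧ y 0 = p.1 ∧
        H p = (y 1 - y 0, ∫ τ in (0 : ℝ)..1, y τ) := by
  obtain ⟨Y, a, hY, hY0, ha, hcurve, hcurve'⟩ := exists_smooth_family hg hξ h0
  have hextend (y : CInterval) : extend y 0 = y 0 := extend_of_mem y (left_mem_Icc.2 zero_le_one)
  let H (p : ℝ × ℝ) := incrementIntegral (Y p)
  have hH' (p) : fderiv ℝ H 0 p = incrementIntegral (fderiv ℝ Y 0 p) :=
    DFunLike.congr_fun (incrementIntegral.hasFDerivAt.comp 0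
      (hY.differentiableAt (by simp)).hasFDerivAt).fderiv p
  have hker {p : ℝ × ℝ} (hper : (fderiv ℝ H 0 p).1 = 0)
      (hzero : ∃ t ∈ Icc (0 : ℝ) 1, extend (fderiv ℝ Y 0 p) t = 0) : p = 0 := by
    rw [hH', incrementIntegral_apply] at hper
    obtain ⟨hl, hy⟩ :=
      eq_zero_of_periodic_of_exists_zero ha (hcurve' p).2 (sub_eq_zero.1 hper) hzero
    exact Prod.ext ((hcurve' p).1.symm.trans
      ((hextend _).symm.trans (hy (left_mem_Icc.2 zero_le_one)))) hl
  refine ⟨H, incrementIntegral.contDiff.contDiffAt.comp 0 hY, by simp only [H, hY0, map_zero],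
    (injective_iff_map_eq_zero _).2 fun p hp => ?_, fun h => ?_, ?_⟩
  · refine hker (congrArg Prod.fst hp)
      (exists_zero_of_integral_eq_zero (continuous_extend _).continuousOn ?_)
    rw [hH', incrementIntegral_apply] at hp
    exact congrArg Prod.snd hp
  · have hp := hker h ⟨0, left_mem_Icc.2 zero_le_one, (hextend _).trans (hcurve' (0, 1)).1⟩
    exact one_ne_zero (congrArg Prod.snd hp)
  · filter_upwards [hcurve] with p hp
    exact ⟨extend (Y p), hp.2, (hextend _).trans hp.1, incrementIntegral_apply _⟩

theorem exists_return_and_periodic_family (hg : ContDiff ℝ ∞ g) (hξ : Continuous ξ)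
    (h0 : ∀ t, g (ξ t, 0) = 0) :
    ∃ R L : ℝ → ℝ, ContDiffAt ℝ ∞ R 0 ∧ ContDiffAt ℝ ∞ L 0 ∧ L 0 = 0 ∧
      (∀ᶠ c in 𝓝 0, ∃ y : ℝ → ℝ, IsIntegralCurveOn y (fun t x => g (ξ t, x)) (Icc 0 1) ∧
        y 0 = c ∧ y 1 = c + R c) ∧
      (∀ᶠ s in 𝓝 0, ∃ y : ℝ → ℝ, IsIntegralCurveOn y (fun t x => g (ξ t, x) + L s) (Icc 0 1) ∧
        y 1 = y 0 ∧ ∫ τ in (0 : ℝ)..1, y τ = s) ∧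
      ∀ k : ℕ, (∀ i ≤ k, iteratedDeriv i R 0 = 0) ↔ ∀ i ≤ k, iteratedDeriv i L 0 = 0 := by
  obtain ⟨H, hH, hH0, hinj, hvert, hcurve⟩ := exists_increment_integral_family hg hξ h0
  obtain ⟨c, L, hc, hL, hc0, hL0, hc', hcL⟩ := exists_curve_of_injective_fderiv hH hH0 hinj hvert
  have hP : ContDiffAt ℝ ∞ (fun p => (H p).1) 0 := contDiff_fst.contDiffAt.comp 0 hH
  have hP' : fderiv ℝ (fun p => (H p).1) 0 (0, 1) ≠ 0 := by
    rwa [fderiv.fst (hH.differentiableAt (by simp))]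
  refine ⟨fun x => (H (x, 0)).1, L,
    hP.comp (f := fun x => (x, 0)) 0 (contDiffAt_id.prodMk contDiffAt_const), hL,
    hL0, ?_, ?_, fun k => iteratedDeriv_eq_zero_iff_of_eventually_eq_zero
      hP hP' hc hc0 hc' hL hL0 (hcL.mono fun s hs => congrArg Prod.fst hs)⟩
  · have hlim : Filter.Tendsto (fun x : ℝ => (x, (0 : ℝ))) (𝓝 0) (𝓝 0) :=
      (Continuous.prodMk_left 0).tendsto' 0 0 rfl
    filter_upwards [hlim.eventually hcurve] with x ⟨y, hy, hy0, hHy⟩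
    refine ⟨y, by simpa only [add_zero] using hy, hy0, ?_⟩
    rw [hHy, hy0, add_sub_cancel]
  · have hlim : Filter.Tendsto (fun s => (c s, L s)) (𝓝 0) (𝓝 (c 0, L 0)) :=
      hc.continuousAt.prodMk hL.continuousAt
    rw [hc0, hL0] at hlim
    filter_upwards [hlim.eventually hcurve, hcL] with s ⟨y, hy, _, hHy⟩ hs
    rw [hHy, Prod.mk.injEq, sub_eq_zero] at hs
    exact ⟨y, hy, hs⟩

end ReturnAndPeriodic

section Uniqueness

variable {E : Type*} [NormedAddCommGroup E] [NormedSpace ℝ E] {g : E × ℝ → ℝ} {ξ : ℝ → E}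
  {x y : ℝ → ℝ} {l m : ℝ}

theorem exists_isIntegralCurveOn_linear_sub (hg : ContDiff ℝ ∞ g) (hξ : Continuous ξ)
    (hx : IsIntegralCurveOn x (fun t z => g (ξ t, z) + l) (Icc 0 1))
    (hy : IsIntegralCurveOn y (fun t z => g (ξ t, z) + m) (Icc 0 1)) :
    ∃ a : ℝ → ℝ, Continuous a ∧
      IsIntegralCurveOn (y - x) (fun t z => a t * z + (m - l)) (Icc 0 1) := by
  obtain ⟨a, ha, hdiff⟩ := exists_continuous_divided_difference hg hξ
    (hx.continuousOn.domRestrict.Icc_extend' (h := zero_le_one))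
    (hy.continuousOn.domRestrict.Icc_extend' (h := zero_le_one))
  refine ⟨a, ha, fun t ht => ((hy t ht).sub (hx t ht)).congr_deriv ?_⟩
  have hdiff_t := hdiff t
  simp only [IccExtend_of_mem _ _ ht, domRestrict_apply] at hdiff_t
  rw [Pi.sub_apply]
  linear_combination hdiff_t

theorem eqOn_of_isIntegralCurveOn (hg : ContDiff ℝ ∞ g) (hξ : Continuous ξ)
    (hx : IsIntegralCurveOn x (fun t z => g (ξ t, z) + l) (Icc 0 1))
    (hy : IsIntegralCurveOn y (fun t z => g (ξ t, z) + l) (Icc 0 1)) (h0 : y 0 = x 0) :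
    EqOn y x (Icc 0 1) := by
  obtain ⟨a, ha, hsub⟩ := exists_isIntegralCurveOn_linear_sub hg hξ hx hy
  simp only [sub_self, add_zero] at hsub
  exact fun t ht => sub_eq_zero.1
    (eqOn_zero_of_isIntegralCurveOn_linear ha hsub (sub_eq_zero.2 h0) ht)

theorem eqOn_of_isIntegralCurveOn_of_periodic (hg : ContDiff ℝ ∞ g) (hξ : Continuous ξ)
    (hx : IsIntegralCurveOn x (fun t z => g (ξ t, z) + l) (Icc 0 1))
    (hy : IsIntegralCurveOn y (fun t z => g (ξ t, z) + m) (Icc 0 1))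
    (hx1 : x 1 = x 0) (hy1 : y 1 = y 0) (hint : ∫ τ in (0 : ℝ)..1, y τ = ∫ τ in (0 : ℝ)..1, x τ) :
    EqOn y x (Icc 0 1) := by
  obtain ⟨a, ha, hsub⟩ := exists_isIntegralCurveOn_linear_sub hg hξ hx hy
  have hint' : ∫ τ in (0 : ℝ)..1, (y - x) τ = 0 :=
    (intervalIntegral.integral_sub (μ := volume)
      (hy.continuousOn.intervalIntegrable_of_Icc zero_le_one)
      (hx.continuousOn.intervalIntegrable_of_Icc zero_le_one)).trans (sub_eq_zero.2 hint)
  have hzero := eq_zero_of_periodic_of_exists_zero ha hsub (by simp only [Pi.sub_apply, hx1, hy1])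
    (exists_zero_of_integral_eq_zero hsub.continuousOn hint')
  exact fun t ht => sub_eq_zero.1 (hzero.2 ht)

end Uniqueness

section Circle

theorem continuous_lift (u : C(UnitAddCircle, ℝ)) : Continuous fun t : ℝ => u t :=
  u.continuous.comp (AddCircle.continuous_mk' 1)

theorem mean_eq_integral (g : UnitAddCircle → ℝ) : mean g = ∫ t in (0 : ℝ)..1, g t := by
  simpa only [mean, zero_add] using (UnitAddCircle.intervalIntegral_preimage 0 g).symm

theorem ext_of_eqOn_Icc {u v : C(UnitAddCircle, ℝ)}
    (h : EqOn (fun t : ℝ => u t) (fun t : ℝ => v t) (Icc 0 1)) : u = v :=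
  DFunLike.coe_injective <| AddCircle.Ico_ext 1 0 fun t ht =>
    h (Ico_subset_Icc_self (by rwa [zero_add] at ht))

theorem exists_eqOn_Icc {y : ℝ → ℝ} (hy : ContinuousOn y (Icc 0 1)) (hper : y 1 = y 0) :
    ∃ z : C(UnitAddCircle, ℝ), EqOn (fun t : ℝ => z t) y (Icc 0 1) := by
  have hIco (t : ℝ) (ht : t ∈ Ico (0 : ℝ) 1) : AddCircle.liftIco 1 0 y t = y t :=
    AddCircle.liftIco_coe_apply (by rwa [zero_add])
  refine ⟨⟨AddCircle.liftIco 1 0 y, AddCircle.liftIco_zero_continuous hper.symm hy⟩,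
    fun t ht => ?_⟩
  rcases ht.2.eq_or_lt with rfl | ht1
  · exact (congrArg _ (AddCircle.coe_period 1)).trans ((hIco 0 (by simp)).trans hper.symm)
  · exact hIco t ⟨ht.1, ht1⟩

theorem hasDerivAt_of_hasDerivWithinAt_Icc {z q : C(UnitAddCircle, ℝ)}
    (h : ∀ t ∈ Icc (0 : ℝ) 1, HasDerivWithinAt (fun s : ℝ => z s) (q t) (Icc 0 1) t) (t : ℝ) :
    HasDerivAt (fun s : ℝ => z s) (q t) t := by
  obtain ⟨n, ⟨ht0, ht1⟩, -⟩ := existsUnique_add_zsmul_mem_Ico (zero_lt_one' ℝ) t 0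
  rw [zsmul_one] at ht0 ht1
  rw [zero_add] at ht1
  suffices hn : HasDerivAt (fun s : ℝ => z s) (q (t + n : ℝ)) (t + n) by
    simpa using hn.comp_add_const t n
  rcases ht0.eq_or_lt with h0 | h0
  · rw [← h0]
    have hright := (h 0 (by simp)).mono_of_mem_nhdsWithin (Icc_mem_nhdsGE zero_lt_one)
    have hleft := (h 1 (by simp)).mono_of_mem_nhdsWithin (Icc_mem_nhdsLE zero_lt_one)
    have hleft0 : HasDerivWithinAt (fun s : ℝ => z s) (q (0 : ℝ)) (Iic 0) 0 := by
      have hcomp := HasDerivWithinAt.scomp_of_eq (0 : ℝ) hleft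
        ((hasDerivWithinAt_id 0 (Iic 0)).add_const (1 : ℝ)) (fun s hs => by simpa using hs)
        (by simp)
      rw [show ((1 : ℝ) : UnitAddCircle) = (0 : ℝ) from AddCircle.coe_period 1] at hcomp
      simpa [Function.comp_def] using hcomp
    simpa using hleft0.union hright
  · exact (h _ ⟨h0.le, ht1.le⟩).hasDerivAt (Icc_mem_nhds h0 ht1)

theorem ae_circle_iff_ae_Icc {p : UnitAddCircle → Prop} :
    (∀ᵐ x, p x) ↔ ∀ᵐ t : ℝ ∂volume.restrict (Icc 0 1), p t := by
  rw [← restrict_Ioc_eq_restrict_Icc]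
  have hmk := UnitAddCircle.measurePreserving_mk 0
  have hequiv := AddCircle.measurePreserving_equivIoc (1 : ℝ) (a := 0)
  rw [zero_add] at hmk
  refine ⟨hmk.quasiMeasurePreserving.ae, fun h => ?_⟩
  have hsub : ∀ᵐ t : Ioc (0 : ℝ) (0 + 1) ∂Measure.comap Subtype.val volume, p (t : ℝ) :=
    (ae_restrict_iff_subtype (p := fun t : ℝ => p t) measurableSet_Ioc).1 (by rwa [zero_add])
  filter_upwards [hequiv.quasiMeasurePreserving.ae hsub] with x hx
  simpa using hx

theorem map_coe_one (u : C(UnitAddCircle, ℝ)) : u (1 : ℝ) = u (0 : ℝ) :=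
  congrArg u (AddCircle.coe_period 1)

theorem integral_sub_eq (x u : C(UnitAddCircle, ℝ)) :
    ∫ t in (0 : ℝ)..1, (x t - u t) = mean x - mean u := by
  rw [mean_eq_integral, mean_eq_integral]
  exact intervalIntegral.integral_sub ((continuous_lift x).intervalIntegrable 0 1)
    ((continuous_lift u).intervalIntegrable 0 1)

end Circle

section AbsolutelyContinuous

theorem hasDerivWithinAt_of_ae_hasDerivAt {y q : ℝ → ℝ}
    (hy : AbsolutelyContinuousOnInterval y 0 1) (hq : ContinuousOn q (Icc 0 1))
    (hyq : ∀ᵐ t ∂volume.restrict (Icc (0 : ℝ) 1), HasDerivAt y (q t) t) :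
    ∀ t ∈ Icc (0 : ℝ) 1, HasDerivWithinAt y (q t) (Icc 0 1) t := by
  rw [ae_restrict_iff' measurableSet_Icc] at hyq
  have hqc : Continuous (IccExtend zero_le_one ((Icc 0 1).domRestrict q)) :=
    hq.domRestrict.Icc_extend'
  have hq_eq (t : ℝ) (ht : t ∈ Icc (0 : ℝ) 1) :
      IccExtend zero_le_one ((Icc 0 1).domRestrict q) t = q t := IccExtend_of_mem _ _ ht
  generalize IccExtend zero_le_one ((Icc 0 1).domRestrict q) = r at hqc hq_eq
  have hr (t : ℝ) : HasDerivAt (fun t => ∫ τ in 0..t, r τ) (r t) t :=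
    (hqc.integral_hasStrictDerivAt 0 t).hasDerivAt
  have hrac : AbsolutelyContinuousOnInterval (fun t => ∫ τ in 0..t, r τ) 0 1 :=
    (hqc.intervalIntegrable 0 1).absolutelyContinuousOnInterval_intervalIntegral (by simp)
  obtain ⟨C, hC⟩ := (hy.sub hrac).const_of_ae_hasDerivAt_zero <| by
    filter_upwards [hyq] with t ht_deriv ht
    rw [uIcc_of_le zero_le_one] at ht
    exact ((ht_deriv ht).sub (hr t)).congr_deriv (by rw [hq_eq t ht, sub_self])
  rw [uIcc_of_le zero_le_one] at hC
  intro t ht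
  rw [← hq_eq t ht]
  exact ((hr t).const_add C).hasDerivWithinAt.congr_of_mem
    (fun s hs => sub_eq_iff_eq_add.1 (hC s hs)) ht

theorem isIntegralCurveOn_Icc_iff_absolutelyContinuous {h : ℝ → ℝ → ℝ}
    (hh : Continuous (Function.uncurry h)) {y : ℝ → ℝ} :
    IsIntegralCurveOn y h (Icc 0 1) ↔ AbsolutelyContinuousOnInterval y 0 1 ∧
      ∀ᵐ t ∂volume.restrict (Icc (0 : ℝ) 1), HasDerivAt y (h t (y t)) t := by
  have hcont (hy : ContinuousOn y (Icc 0 1)) : ContinuousOn (fun t => h t (y t)) (Icc 0 1) :=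
    hh.comp_continuousOn (continuousOn_id.prodMk hy)
  constructor
  · intro hy
    refine ⟨ContDiffOn.absolutelyContinuousOnInterval ?_, ?_⟩
    · rw [uIcc_of_le zero_le_one, contDiffOn_one_iff_derivWithin (uniqueDiffOn_Icc zero_lt_one)]
      refine ⟨fun t ht => (hy t ht).differentiableWithinAt, (hcont hy.continuousOn).congr ?_⟩
      exact fun t ht => (hy t ht).derivWithin (uniqueDiffOn_Icc zero_lt_one t ht)
    · rw [← restrict_Ioo_eq_restrict_Icc, ae_restrict_iff' measurableSet_Ioo]
      exact .of_forall fun t ht =>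
        (hy t (Ioo_subset_Icc_self ht)).hasDerivAt (Icc_mem_nhds ht.1 ht.2)
  · rintro ⟨hac, hae⟩
    have hc : ContinuousOn y (Icc 0 1) := by
      simpa only [uIcc_of_le zero_le_one] using hac.continuousOn
    exact hasDerivWithinAt_of_ae_hasDerivAt hac (hcont hc) hae

end AbsolutelyContinuous

section Contact

variable {ρ R φ L : ℝ → ℝ} {x m : ℝ}

theorem eventuallyEq_id_add_comp_sub (h : ∀ᶠ c in 𝓝 0, ρ (x + c) = x + c + R c) :
    ρ =ᶠ[𝓝 x] id + fun z => R (z - x) := by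
  have hlim : Filter.Tendsto (fun z => z - x) (𝓝 x) (𝓝 0) :=
    (continuous_sub_right x).tendsto' x 0 (sub_self x)
  filter_upwards [hlim.eventually h] with z hz
  rwa [add_sub_cancel] at hz

theorem contDiffAt_comp_sub {n : WithTop ℕ∞} (hR : ContDiffAt ℝ n R 0) :
    ContDiffAt ℝ n (fun z => R (z - x)) x :=
  ContDiffAt.comp x (by rwa [sub_self]) (contDiffAt_id.sub contDiffAt_const)

theorem contDiffAt_of_eventually_eq_add {n : WithTop ℕ∞} (hR : ContDiffAt ℝ n R 0)
    (h : ∀ᶠ c in 𝓝 0, ρ (x + c) = x + c + R c) : ContDiffAt ℝ n ρ x :=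
  (contDiffAt_id.add (contDiffAt_comp_sub hR)).congr_of_eventuallyEq
    (eventuallyEq_id_add_comp_sub h)

theorem iteratedDeriv_eq_iteratedDeriv_id_iff {i : ℕ} (hR : ContDiffAt ℝ i R 0)
    (h : ∀ᶠ c in 𝓝 0, ρ (x + c) = x + c + R c) :
    iteratedDeriv i ρ x = iteratedDeriv i id x ↔ iteratedDeriv i R 0 = 0 := by
  rw [((eventuallyEq_id_add_comp_sub h).iteratedDeriv i).eq_of_nhds,
    iteratedDeriv_add contDiffAt_id (contDiffAt_comp_sub hR), add_eq_left,
    congrFun (iteratedDeriv_comp_sub_const i R x) x, sub_self]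

theorem forall_iteratedDeriv_eq_id_iff {k : ℕ} (hρ : ρ x = x) (hk : 1 ≤ k) :
    (∀ i ≤ k, iteratedDeriv i ρ x = iteratedDeriv i id x) ↔
      deriv ρ x = 1 ∧ ∀ i : ℕ, 2 ≤ i → i ≤ k → iteratedDeriv i ρ x = 0 := by
  simp only [iteratedDeriv_id]
  refine ⟨fun h => ⟨by simpa using h 1 hk, fun i hi hik => ?_⟩, fun ⟨h1, h2⟩ i hik => ?_⟩
  · simpa [show i ≠ 0 by lia, show i ≠ 1 by lia] using h i hik
  · match i with
    | 0 => simpa using hρ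
    | 1 => simpa using h1
    | i + 2 => simpa using h2 (i + 2) (by lia) hik

theorem forall_pos_iteratedDeriv_eq_zero_iff {k : ℕ} (hL : L 0 = 0)
    (h : φ =ᶠ[𝓝 0] fun s => m + L s) :
    (∀ i, 1 ≤ i → i ≤ k → iteratedDeriv i φ 0 = 0) ↔ ∀ i ≤ k, iteratedDeriv i L 0 = 0 := by
  have hφ (i : ℕ) (hi : 1 ≤ i) : iteratedDeriv i φ 0 = iteratedDeriv i L 0 := by
    rw [(h.iteratedDeriv i).eq_of_nhds, iteratedDeriv_const_add hi]
  refine ⟨fun hzero i hik => ?_, fun hzero i hi hik => (hφ i hi).trans (hzero i hik)⟩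
  rcases Nat.eq_zero_or_pos i with rfl | hi
  · rwa [iteratedDeriv_zero]
  · exact (hφ i hi).symm.trans (hzero i hi hik)

end Contact

section Setting

/-- The nonlinearity of the equation satisfied by a difference: if `u' + f(t, u) = v`, then
`w' + f(t, w) = v + l` if and only if `y = w - u` satisfies
`y' = f.difference ((t, u(t)), y) + l`. -/
def Nonlinearity.difference (f : Nonlinearity) (p : (ℝ × ℝ) × ℝ) : ℝ :=
  f p.1.1 p.1.2 - f p.1.1 (p.1.2 + p.2)

theorem Nonlinearity.contDiff_difference (f : Nonlinearity) : ContDiff ℝ ∞ f.difference :=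
  (f.smooth.comp contDiff_fst).sub
    (f.smooth.comp (contDiff_fst.fst.prodMk (contDiff_fst.snd.add contDiff_snd)))

theorem Nonlinearity.difference_zero (f : Nonlinearity) (p : ℝ × ℝ) : f.difference (p, 0) = 0 := by
  simp only [difference, add_zero, sub_self]

/-- What the two choices of spaces `(C¹, C⁰)` and `(H¹, L²)` have in common: the operator
`F : X → V`, the constants and the average on `V`, and the notion of solution of
`w' + f(t, w) = v` on `[0, 1]`. Since `u` solves the equation with `v = F(u)`, the equations with
right-hand side `F(u) + const` are expressed through the difference to `u`, which is a classical
solution of an equation with continuous right-hand side, even if `u` is only in `H¹`. -/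
structure FunctionSpaces (f : Nonlinearity) (X V : Type) [AddCommGroup V] where
  toMap : X → C(UnitAddCircle, ℝ)
  op : X → V
  const : ℝ →+ V
  avg : V → ℝ
  IsSolution : V → (ℝ → ℝ) → Prop
  toMap_injective : Function.Injective toMap
  avg_add_const (v : V) (l : ℝ) : avg (v + const l) = avg v + l
  exists_op_eq_iff (v : V) (x : C(UnitAddCircle, ℝ)) :
    (∃ y, toMap y = x ∧ op y = v) ↔ IsSolution v (fun t => x t)
  isSolution_op_add_const_iff (u : X) (l : ℝ) (w : ℝ → ℝ) : IsSolution (op u + const l) w ↔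
    IsIntegralCurveOn (fun t => w t - toMap u t) (fun t y => f.difference ((t, toMap u t), y) + l)
      (Icc 0 1)

namespace FunctionSpaces

variable {f : Nonlinearity} {X V : Type} [AddCommGroup V] (S : FunctionSpaces f X V) (u : X)
  {w y : ℝ → ℝ} {l : ℝ}

theorem continuous_graph : Continuous fun t : ℝ => (t, S.toMap u t) :=
  continuous_id.prodMk (continuous_lift _)

/-- The map `Ψ`. -/
noncomputable def psi : V := S.op u - S.const (S.avg (S.op u)) + S.const (mean (S.toMap u))

/-- The function `φ`, meaningful on the image of `Ψ`. -/
noncomputable def phi [Nonempty X] (z : V) : ℝ := S.avg (S.op (Function.invFun S.psi z))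

/-- The set `S_k`. -/
def stratum [Nonempty X] (k : ℕ) : Set X :=
  {u | ∀ i : ℕ, 1 ≤ i → i ≤ k → iteratedDeriv i (fun s : ℝ => S.phi (S.psi u + S.const s)) 0 = 0}

/-- The return map `ρ_v` for `v = F(u)`. -/
noncomputable abbrev rho : ℝ → ℝ := returnMap (S.IsSolution (S.op u))

theorem psi_eq : S.psi u = S.op u + S.const (mean (S.toMap u) - S.avg (S.op u)) := by
  rw [psi, map_sub]
  abel

theorem avg_psi : S.avg (S.psi u) = mean (S.toMap u) := by
  rw [psi_eq, avg_add_const, add_sub_cancel]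

theorem psi_eq_add_const {x : X} {s : ℝ} (hop : S.op x = S.op u + S.const l)
    (hmean : mean (S.toMap x) = mean (S.toMap u) + s) : S.psi x = S.psi u + S.const s := by
  rw [psi_eq, psi_eq, hop, hmean, avg_add_const, add_assoc, add_assoc, ← map_add, ← map_add]
  congr 2
  ring

theorem isSolution_self : S.IsSolution (S.op u) (fun t => S.toMap u t) :=
  (S.exists_op_eq_iff _ _).1 ⟨u, rfl, rfl⟩

theorem isSolution_op_iff : S.IsSolution (S.op u) w ↔
    IsIntegralCurveOn (fun t => w t - S.toMap u t)
      (fun t y => f.difference ((t, S.toMap u t), y) + 0) (Icc 0 1) := by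
  rw [← isSolution_op_add_const_iff, map_zero, add_zero]

theorem psi_injective : Function.Injective S.psi := by
  intro x u h
  have hmean : mean (S.toMap x) = mean (S.toMap u) := by rw [← avg_psi, ← avg_psi, h]
  have hop : S.op x = S.op u + S.const (S.avg (S.op x) - S.avg (S.op u)) := by
    rw [psi_eq, psi_eq, hmean, map_sub, map_sub, add_sub, add_sub, sub_eq_sub_iff_add_eq_add] at h
    rw [map_sub, add_sub, eq_sub_iff_add_eq]
    refine add_right_cancel (b := S.const (mean (S.toMap u))) ?_
    rw [add_right_comm, h, add_right_comm]
  have heq := eqOn_of_isIntegralCurveOn_of_periodic f.contDiff_difference (S.continuous_graph u)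
    ((S.isSolution_op_iff u).1 (S.isSolution_self u))
    ((S.isSolution_op_add_const_iff u _ _).1 (hop ▸ S.isSolution_self x))
    (by simp only [sub_self]) (by simp only [map_coe_one])
    (by rw [integral_sub_eq, integral_sub_eq, hmean])
  exact S.toMap_injective (ext_of_eqOn_Icc fun t ht => sub_left_injective (heq ht))

theorem rho_apply (hw : S.IsSolution (S.op u) w) : S.rho u (w 0) = w 1 := by
  have hex : ∃ w', S.IsSolution (S.op u) w' ∧ w' 0 = w 0 := ⟨w, hw, rfl⟩
  rw [rho, returnMap, dif_pos hex]
  obtain ⟨hsol, h0⟩ := hex.choose_spec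
  rw [S.isSolution_op_iff] at hsol hw
  have heq := eqOn_of_isIntegralCurveOn f.contDiff_difference (S.continuous_graph u) hw hsol
    (by simp only [h0])
  exact sub_left_injective (heq (right_mem_Icc.2 zero_le_one))

theorem isSolution_add
    (hy : IsIntegralCurveOn y (fun t y => f.difference ((t, S.toMap u t), y)) (Icc 0 1)) :
    S.IsSolution (S.op u) (fun t => S.toMap u t + y t) :=
  (S.isSolution_op_iff u).2 (by simpa only [add_zero, add_sub_cancel_left] using hy)

theorem exists_psi_eq_add_const
    (hy : IsIntegralCurveOn y (fun t y => f.difference ((t, S.toMap u t), y) + l) (Icc 0 1))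
    (hper : y 1 = y 0) : ∃ x, S.psi x = S.psi u + S.const (∫ t in (0 : ℝ)..1, y t) ∧
      S.avg (S.op x) = S.avg (S.op u) + l := by
  obtain ⟨z, hz⟩ := exists_eqOn_Icc hy.continuousOn hper
  have hsub (t : ℝ) (ht : t ∈ Icc (0 : ℝ) 1) : (S.toMap u + z) t - S.toMap u t = y t :=
    (add_sub_cancel_left _ _).trans (hz ht)
  obtain ⟨x, hx, hop⟩ := (S.exists_op_eq_iff (S.op u + S.const l) (S.toMap u + z)).2 <|
    (S.isSolution_op_add_const_iff u l _).2 fun t ht => by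
      simpa only [hsub t ht] using (hy t ht).congr_of_mem hsub ht
  refine ⟨x, S.psi_eq_add_const u hop ?_, by rw [hop, avg_add_const]⟩
  rw [hx, ← sub_eq_iff_eq_add', ← integral_sub_eq]
  exact intervalIntegral.integral_congr fun t ht => hsub t (uIcc_of_le (zero_le_one' ℝ) ▸ ht)

theorem rho_self : S.rho u (S.toMap u 0) = S.toMap u 0 :=
  (S.rho_apply u (S.isSolution_self u)).trans (map_coe_one _)

variable [Nonempty X]

theorem phi_psi : S.phi (S.psi u) = S.avg (S.op u) := by
  rw [phi, Function.leftInverse_invFun S.psi_injective]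

theorem exists_local_expansion : ∃ R L : ℝ → ℝ, ContDiffAt ℝ ∞ R 0 ∧
    ContDiffAt ℝ ∞ L 0 ∧ L 0 = 0 ∧
    (∀ᶠ c in 𝓝 0, S.toMap u 0 + c ∈ returnDomain (S.IsSolution (S.op u)) ∧
      S.rho u (S.toMap u 0 + c) = S.toMap u 0 + c + R c) ∧
    (∀ᶠ s in 𝓝 0, S.psi u + S.const s ∈ range S.psi ∧
      S.phi (S.psi u + S.const s) = S.avg (S.op u) + L s) ∧
    ∀ k : ℕ, (∀ i ≤ k, iteratedDeriv i R 0 = 0) ↔ ∀ i ≤ k, iteratedDeriv i L 0 = 0 := by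
  obtain ⟨R, L, hR, hL, hL0, hreturn, hperiodic, hRL⟩ := exists_return_and_periodic_family
    f.contDiff_difference (S.continuous_graph u) (fun t => f.difference_zero _)
  refine ⟨R, L, hR, hL, hL0, hreturn.mono ?_, hperiodic.mono ?_, hRL⟩
  · rintro c ⟨y, hy, rfl, hy1⟩
    have hsol := S.isSolution_add u hy
    refine ⟨⟨_, hsol, rfl⟩, (S.rho_apply u hsol).trans ?_⟩
    rw [hy1, map_coe_one, add_assoc]
    rfl
  · rintro s ⟨y, hy, hper, rfl⟩
    obtain ⟨x, hpsi, havg⟩ := S.exists_psi_eq_add_const u hy hper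
    exact ⟨⟨x, hpsi⟩, by rw [← hpsi, phi_psi, havg]⟩

theorem eventually_psi_add_const_mem_range :
    ∀ᶠ s in 𝓝 0, S.psi u + S.const s ∈ range S.psi := by
  obtain ⟨R, L, -, -, -, -, hphi, -⟩ := S.exists_local_expansion u
  exact hphi.mono fun s hs => hs.1

theorem contDiffAt_phi : ContDiffAt ℝ ∞ (fun s => S.phi (S.psi u + S.const s)) 0 := by
  obtain ⟨R, L, -, hL, -, -, hphi, -⟩ := S.exists_local_expansion u
  exact (contDiffAt_const.add hL).congr_of_eventuallyEq (hphi.mono fun s hs => hs.2)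

theorem returnDomain_mem_nhds : returnDomain (S.IsSolution (S.op u)) ∈ 𝓝 (S.toMap u 0) := by
  obtain ⟨R, L, -, -, -, hrho, -, -⟩ := S.exists_local_expansion u
  rw [← map_add_left_nhds_zero]
  exact hrho.mono fun c hc => hc.1

theorem contDiffAt_rho : ContDiffAt ℝ ∞ (S.rho u) (S.toMap u 0) := by
  obtain ⟨R, L, hR, -, -, hrho, -, -⟩ := S.exists_local_expansion u
  exact contDiffAt_of_eventually_eq_add hR (hrho.mono fun c hc => hc.2)

theorem mem_stratum_iff {k : ℕ} : u ∈ S.stratum k ↔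
    ∀ i ≤ k, iteratedDeriv i (S.rho u) (S.toMap u 0) = iteratedDeriv i id (S.toMap u 0) := by
  obtain ⟨R, L, hR, -, hL0, hrho, hphi, hRL⟩ := S.exists_local_expansion u
  refine (forall_pos_iteratedDeriv_eq_zero_iff hL0 (hphi.mono fun s hs => hs.2)).trans
    ((hRL k).symm.trans (forall₂_congr fun i _ => Iff.symm ?_))
  exact iteratedDeriv_eq_iteratedDeriv_id_iff (hR.of_le (mod_cast le_top))
    (hrho.mono fun c hc => hc.2)

theorem mem_stratum_iff_deriv {k : ℕ} (hk : 1 ≤ k) : u ∈ S.stratum k ↔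
    deriv (S.rho u) (S.toMap u 0) = 1 ∧
      ∀ i : ℕ, 2 ≤ i → i ≤ k → iteratedDeriv i (S.rho u) (S.toMap u 0) = 0 :=
  (S.mem_stratum_iff u).trans (forall_iteratedDeriv_eq_id_iff (S.rho_self u) hk)

theorem stratumOrder_eq_contactOrder :
    stratumOrder S.stratum u = contactOrder (S.rho u) id (S.toMap u 0) := by
  simp only [stratumOrder, contactOrder, mem_stratum_iff]

end FunctionSpaces

end Setting

section Difference

variable {w u : ℝ → ℝ} {u' d : ℝ} {s : Set ℝ} {t : ℝ}

theorem hasDerivWithinAt_sub_iff (hu : HasDerivWithinAt u u' s t) :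
    HasDerivWithinAt (fun t => w t - u t) d s t ↔ HasDerivWithinAt w (u' + d) s t := by
  refine ⟨fun h => ?_, fun h => (h.sub hu).congr_deriv (add_sub_cancel_left _ _)⟩
  exact (hu.add h).congr_of_eventuallyEq (.of_forall fun τ => (add_sub_cancel _ _).symm)
    (add_sub_cancel _ _).symm

theorem hasDerivAt_sub_iff (hu : HasDerivAt u u' t) :
    HasDerivAt (fun t => w t - u t) d t ↔ HasDerivAt w (u' + d) t := by
  simpa only [hasDerivWithinAt_univ] using hasDerivWithinAt_sub_iff (s := univ)
    hu.hasDerivWithinAt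

theorem odeOp_add_sub (f : Nonlinearity) (u : UnitAddCircle → ℝ) (t l c : ℝ) :
    odeOp f u t + l - f t c = circleDeriv u t + (f.difference ((t, u t), c - u t) + l) := by
  rw [odeOp, Nonlinearity.difference, add_sub_cancel]
  ring

end Difference

section ContinuouslyDifferentiable

variable {f : Nonlinearity}

theorem C1Circle.hasDerivAt (u : C1Circle) (t : ℝ) :
    HasDerivAt (fun s : ℝ => u.1 s) (circleDeriv u.1 t) t := by
  rw [circleDeriv_coe]
  exact (u.2.differentiable one_ne_zero t).hasDerivAt

theorem mean_add_constC (g : C(UnitAddCircle, ℝ)) (l : ℝ) : mean ⇑(g + constC l) = mean g + l := by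
  rw [← sub_eq_iff_eq_add', ← integral_sub_eq]
  simp [constC]

theorem isSolutionC_opC_add_iff (u : C1Circle) (l : ℝ) (w : ℝ → ℝ) :
    IsSolutionC f (opC f u + constC l) w ↔ IsIntegralCurveOn (fun t => w t - u.1 t)
      (fun t y => f.difference ((t, u.1 t), y) + l) (Icc 0 1) := by
  refine forall₂_congr fun t _ => ?_
  rw [hasDerivWithinAt_sub_iff (u.hasDerivAt t).hasDerivWithinAt, ← odeOp_add_sub]
  rfl

theorem exists_opC_eq_iff (v x : C(UnitAddCircle, ℝ)) :
    (∃ y : C1Circle, y.1 = x ∧ opC f y = v) ↔ IsSolutionC f v (fun t => x t) := by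
  constructor
  · rintro ⟨y, rfl, rfl⟩ t -
    refine (y.hasDerivAt t).hasDerivWithinAt.congr_deriv ?_
    exact (add_sub_cancel_right _ _).symm
  · intro h
    let q : C(UnitAddCircle, ℝ) := v - ⟨_, continuous_nemytskii f x⟩
    have hderiv : ∀ t : ℝ, HasDerivAt (fun s : ℝ => x s) (q t) t :=
      hasDerivAt_of_hasDerivWithinAt_Icc h
    refine ⟨⟨x, contDiff_one_iff_deriv.2 ⟨fun t => (hderiv t).differentiableAt, ?_⟩⟩, rfl,
      ext_of_eqOn_Icc fun t _ => ?_⟩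
    · rw [funext fun t => (hderiv t).deriv]
      exact continuous_lift q
    · change circleDeriv x t + f t (x t) = v t
      rw [circleDeriv_coe, (hderiv t).deriv]
      exact sub_add_cancel _ _

/-- The pair `C¹`, `C⁰`, with classical solutions. -/
noncomputable def spacesC (f : Nonlinearity) : FunctionSpaces f C1Circle C(UnitAddCircle, ℝ) where
  toMap := Subtype.val
  op := opC f
  const := ⟨⟨constC, rfl⟩, fun _ _ => rfl⟩
  avg v := mean v
  IsSolution := IsSolutionC f
  toMap_injective := Subtype.val_injective
  avg_add_const := mean_add_constC
  exists_op_eq_iff := exists_opC_eq_iff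
  isSolution_op_add_const_iff := isSolutionC_opC_add_iff

end ContinuouslyDifferentiable

section Sobolev

variable {f : Nonlinearity}

theorem ae_hasDerivAt_of_absolutelyContinuous {u : UnitAddCircle → ℝ}
    (hu : AbsolutelyContinuousOnInterval (fun t : ℝ => u t) 0 1) :
    ∀ᵐ t : ℝ ∂volume.restrict (Icc 0 1),
      HasDerivAt (fun s : ℝ => u s) (circleDeriv u t) t := by
  rw [ae_restrict_iff' measurableSet_Icc]
  filter_upwards [hu.ae_differentiableAt] with t ht htI
  rw [circleDeriv_coe]
  exact (ht (uIcc_of_le (zero_le_one' ℝ) ▸ htI)).hasDerivAt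

theorem coeFn_add_constH (g : L2Circle) (l : ℝ) :
    (g + constH l : L2Circle) =ᵐ[volume] fun x => g x + l := by
  filter_upwards [Lp.coeFn_add g (constH l), Lp.coeFn_const (μ := (volume : Measure UnitAddCircle))
    (p := 2) (c := l)] with x hadd hconst
  rw [hadd, Pi.add_apply, constH, hconst]
  rfl

theorem mean_add_constH (g : L2Circle) (l : ℝ) : mean (g + constH l : L2Circle) = mean g + l := by
  rw [mean, integral_congr_ae (coeFn_add_constH g l), integral_add
    ((Lp.memLp g).integrable one_le_two) (integrable_const l)]
  simp [mean, measureReal_def]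

theorem coeFn_opH_add_constH (u : H1Circle) (l : ℝ) :
    (opH f u + constH l : L2Circle) =ᵐ[volume] fun x => odeOp f u.1 x + l := by
  filter_upwards [coeFn_add_constH (opH f u) l, (memLp_odeOp f u).coeFn_toLp] with x hadd hop
  rw [hadd, opH, hop]

theorem isSolutionH_opH_add_iff (u : H1Circle) (l : ℝ) (w : ℝ → ℝ) :
    IsSolutionH f (opH f u + constH l) w ↔ IsIntegralCurveOn (fun t => w t - u.1 t)
      (fun t y => f.difference ((t, u.1 t), y) + l) (Icc 0 1) := by
  have hcont : Continuous (Function.uncurry fun t y => f.difference ((t, u.1 t), y) + l) :=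
    (f.contDiff_difference.continuous.comp ((continuous_fst.prodMk
      ((continuous_lift u.1).comp continuous_fst)).prodMk continuous_snd)).add continuous_const
  rw [isIntegralCurveOn_Icc_iff_absolutelyContinuous hcont]
  refine and_congr ⟨fun h => h.sub u.2.1, fun h => ?_⟩ (Filter.eventually_congr ?_)
  · simpa only [Pi.add_def, add_sub_cancel] using u.2.1.add h
  · filter_upwards [ae_circle_iff_ae_Icc.1 (coeFn_opH_add_constH u l),
      ae_hasDerivAt_of_absolutelyContinuous u.2.1] with t hop hu
    rw [hasDerivAt_sub_iff hu, hop, odeOp_add_sub]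

theorem exists_opH_eq_iff (v : L2Circle) (x : C(UnitAddCircle, ℝ)) :
    (∃ y : H1Circle, y.1 = x ∧ opH f y = v) ↔ IsSolutionH f v (fun t => x t) := by
  constructor
  · rintro ⟨y, rfl, rfl⟩
    refine ⟨y.2.1, ?_⟩
    filter_upwards [ae_circle_iff_ae_Icc.1 (memLp_odeOp f y).coeFn_toLp,
      ae_hasDerivAt_of_absolutelyContinuous y.2.1] with t hop hy
    rw [opH, hop]
    exact hy.congr_deriv (add_sub_cancel_right _ _).symm
  · rintro ⟨hac, hae⟩
    have hderiv : circleDeriv x =ᵐ[volume] fun t => v t - f t (x t) := by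
      refine ae_circle_iff_ae_Icc.2 (hae.mono fun t ht => ?_)
      rw [circleDeriv_coe, ht.deriv]
    have hmem : MemLp (circleDeriv x) 2 volume := (memLp_congr_ae hderiv).2 <|
      (Lp.memLp v).sub (ContinuousMap.memLp volume ℝ ⟨_, continuous_nemytskii f x⟩)
    refine ⟨⟨x, hac, hmem⟩, rfl, Lp.ext ?_⟩
    filter_upwards [(memLp_odeOp f ⟨x, hac, hmem⟩).coeFn_toLp, hderiv] with t hop ht
    rw [opH, hop, odeOp, ht, sub_add_cancel]

/-- The pair `H¹`, `L²`, with solutions in the sense of Carathéodory. -/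
noncomputable def spacesH (f : Nonlinearity) : FunctionSpaces f H1Circle L2Circle where
  toMap := Subtype.val
  op := opH f
  const := Lp.const 2 volume
  avg v := mean v
  IsSolution := IsSolutionH f
  toMap_injective := Subtype.val_injective
  avg_add_const := mean_add_constH
  exists_op_eq_iff := exists_opH_eq_iff
  isSolution_op_add_const_iff := isSolutionH_opH_add_iff

end Sobolev

end PeriodicODE

theorem proposition2p3 (f : PeriodicODE.Nonlinearity) :
    -- the `C` case, `F : C¹ → C⁰`
    (∀ (u : PeriodicODE.C1Circle) (v : C(UnitAddCircle, ℝ)) (ρ : ℝ → ℝ),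
      v = PeriodicODE.opC f u → ρ = PeriodicODE.returnMap (PeriodicODE.IsSolutionC f v) →
      -- the adapted coordinates defining `S_k` make sense around `u`
      (Function.Injective (PeriodicODE.psiC f) ∧
        (∀ᶠ s in 𝓝 (0 : ℝ),
          PeriodicODE.psiC f u + PeriodicODE.constC s ∈ range (PeriodicODE.psiC f)) ∧
        ContDiffAt ℝ ∞
          (fun s : ℝ => PeriodicODE.phiC f (PeriodicODE.psiC f u + PeriodicODE.constC s)) 0) ∧
      -- the return map is well defined, and smooth near `u(0)`
      ((∀ w : ℝ → ℝ, PeriodicODE.IsSolutionC f v w → ρ (w 0) = w 1) ∧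
        PeriodicODE.returnDomain (PeriodicODE.IsSolutionC f v) ∈ 𝓝 (u.1 0) ∧
        ContDiffAt ℝ ∞ ρ (u.1 0)) ∧
      ρ (u.1 0) = u.1 0 ∧
      (∀ k : ℕ, 1 ≤ k →
        (u ∈ PeriodicODE.stratumC f k ↔
          deriv ρ (u.1 0) = 1 ∧ ∀ i : ℕ, 2 ≤ i → i ≤ k → iteratedDeriv i ρ (u.1 0) = 0)) ∧
      PeriodicODE.stratumOrder (PeriodicODE.stratumC f) u =
        PeriodicODE.contactOrder ρ id (u.1 0)) ∧
    -- the `H` case, `F : H¹ → L²`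
    (∀ (u : PeriodicODE.H1Circle) (v : PeriodicODE.L2Circle) (ρ : ℝ → ℝ),
      v = PeriodicODE.opH f u → ρ = PeriodicODE.returnMap (PeriodicODE.IsSolutionH f v) →
      (Function.Injective (PeriodicODE.psiH f) ∧
        (∀ᶠ s in 𝓝 (0 : ℝ),
          PeriodicODE.psiH f u + PeriodicODE.constH s ∈ range (PeriodicODE.psiH f)) ∧
        ContDiffAt ℝ ∞
          (fun s : ℝ => PeriodicODE.phiH f (PeriodicODE.psiH f u + PeriodicODE.constH s)) 0) ∧
      ((∀ w : ℝ → ℝ, PeriodicODE.IsSolutionH f v w → ρ (w 0) = w 1) ∧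
        PeriodicODE.returnDomain (PeriodicODE.IsSolutionH f v) ∈ 𝓝 (u.1 0) ∧
        ContDiffAt ℝ ∞ ρ (u.1 0)) ∧
      ρ (u.1 0) = u.1 0 ∧
      (∀ k : ℕ, 1 ≤ k →
        (u ∈ PeriodicODE.stratumH f k ↔
          deriv ρ (u.1 0) = 1 ∧ ∀ i : ℕ, 2 ≤ i → i ≤ k → iteratedDeriv i ρ (u.1 0) = 0)) ∧
      PeriodicODE.stratumOrder (PeriodicODE.stratumH f) u =
        PeriodicODE.contactOrder ρ id (u.1 0)) := by
  constructor
  · rintro u v ρ rfl rfl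
    let S := PeriodicODE.spacesC f
    exact ⟨⟨S.psi_injective, S.eventually_psi_add_const_mem_range u, S.contDiffAt_phi u⟩,
      ⟨fun _ => S.rho_apply u, S.returnDomain_mem_nhds u, S.contDiffAt_rho u⟩,
      S.rho_self u, fun _ => S.mem_stratum_iff_deriv u, S.stratumOrder_eq_contactOrder u⟩
  · rintro u v ρ rfl rfl
    let S := PeriodicODE.spacesH f
    exact ⟨⟨S.psi_injective, S.eventually_psi_add_const_mem_range u, S.contDiffAt_phi u⟩,
      ⟨fun _ => S.rho_apply u, S.returnDomain_mem_nhds u, S.contDiffAt_rho u⟩,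
      S.rho_self u, fun _ => S.mem_stratum_iff_deriv u, S.stratumOrder_eq_contactOrder u⟩
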